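/- All graphs are finite, simple and undirected. For a graph $G$, let $\delta G$ be the digraph whose vertices are the ordered pairs $(x,y)$ of adjacent vertices of $G$, with a directed edge from $(x,y)$ to $(z,w)$ whenever $y=z$; its underlying graph is obtained by ignoring the directions of the edges. Let $b(n)=\binom{n}{\lfloor n/2\rfloor}$. An index code of length $k$ over an alphabet $\Sigma$ for a graph $G$ with vertex set $V$ is a function $E:\Sigma^{V}\to\Sigma^k$ such that for every $i\in V$ there is a function $g_i:\Sigma^k\times\Sigma^{N_G(i)}\to\Sigma$ with $g_i(E(x),x|_{N_G(i)})=x_i$ for all $x\in\Sigma^{V}$, where $N_G(i)$ is the set of neighbours of $i$. For an integer $k$ and a real number $r$, let $\mathrm{IC}_\Sigma(k,r)$ be the promise problem whose YES instances are the graphs for which the minimal length of an index code over $\Sigma$ is at most $k$, and whose NO instances are those for which it is at least $r$. Let $\Sigma$ be a finite alphabet with $|\Sigma|\ge 2$, and let $k_1\ge 0$ and $k_2\ge 2$ be integers. Then there is a polynomial-time reduction from the promise problem with YES instances the graphs $G$ with $\chi(G)\le b(k_1)$ and NO instances the graphs $G$ with $\chi(G)\ge k_2$ to the promise problem $\mathrm{IC}_\Sigma(k_1,\log_{|\Sigma|}\log_2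 k_2)$; that is, there is a map from graphs to graphs, computable in time polynomial in the size of the input (graphs being given by their adjacency matrices), that sends YES instances to YES instances and NO instances to NO instances. Moreover, the map can be chosen so that every graph $G$ is sent to a graph isomorphic to the complement of the underlying graph of $\delta G$. -/

import Mathlib

noncomputable section

namespace LineIndex

/-! ### Line digraphs -/

/-- The digraph obtained from a graph by replacing every edge with two oppositely directed
edges. -/
def bidirected {V : Type*} (G : SimpleGraph V) : Digraph V where
  Adj := G.Adj

/-- The line digraph `δD` of a digraph `D`: its vertices are the directed edges of `D`, and there
is an edge from `(x, y)` to `(z, w)` whenever `y = z`. -/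
def lineDigraph {V : Type*} (D : Digraph V) : Digraph {e : V × V // D.Adj e.1 e.2} where
  Adj e f := e.1.2 = f.1.1

/-- The underlying graph of the line digraph `δG` of a graph `G`. (Mathlib's
`Digraph.toSimpleGraphInclusive` joins two distinct vertices if there is a directed edge between
them in at least one direction.) -/
def underlyingLine {V : Type*} (G : SimpleGraph V) :
    SimpleGraph {e : V × V // (bidirected G).Adj e.1 e.2} :=
  (lineDigraph (bidirected G)).toSimpleGraphInclusive

/-- The function `b(n) = binom(n, ⌊n/2⌋)`. -/
def b (n : ℕ) : ℕ := n.choose (n / 2)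

/-! ### Index codes -/

/-- `E` is an index code for `G` over the alphabet `A` of length `k`: every vertex `i` has a
decoding function `g` that recovers `x i` from `E x` and the restriction of `x` to the
neighbours of `i`. -/
def IsIndexCode {V A : Type*} (G : SimpleGraph V) (k : ℕ) (E : (V → A) → (Fin k → A)) : Prop :=
  ∀ i : V, ∃ g : (Fin k → A) → (G.neighborSet i → A) → A,
    ∀ x : V → A, g (E x) (fun j => x j) = x i

/-- The minimal length of an index code for `G` over the alphabet `A`. -/
def indexLength {V : Type*} (G : SimpleGraph V) (A : Type*) : ℕ :=
  sInf {k : ℕ | ∃ E : (V → A) → (Fin k → A), IsIndexCode G k E}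

/-- On a finite vertex set there is always an index code (send the whole message), so that the
minimum in `indexLength` is taken over a nonempty set. -/
theorem exists_isIndexCode {V : Type*} [Fintype V] (G : SimpleGraph V) (A : Type*) :
    ∃ E : (V → A) → (Fin (Fintype.card V) → A), IsIndexCode G (Fintype.card V) E :=
  ⟨fun x j => x ((Fintype.equivFin V).symm j),
    fun i => ⟨fun y _ => y (Fintype.equivFin V i), fun x => by simp⟩⟩

/-! ### Computational problems on graphs -/

/-- A finite graph on the vertex set `Fin n`: an input of a graph problem. -/
structure FinGraph where
  /-- The number of vertices. -/
  n : ℕ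
  /-- The graph. -/
  graph : SimpleGraph (Fin n)

open Classical in
/-- A row of the adjacency matrix, as a list of bits followed by the row separator `none`. -/
def FinGraph.row (G : FinGraph) (i : Fin G.n) : List (Option Bool) :=
  (List.finRange G.n).map (fun j => some (decide (G.graph.Adj i j))) ++ [none]

/-- The encoding of a graph over a three-letter alphabet as its adjacency matrix, row by row. -/
def FinGraph.encode (G : FinGraph) : List (Option Bool) :=
  ((List.finRange G.n).map G.row).flatten

theorem FinGraph.length_row (G : FinGraph) (i : Fin G.n) : (G.row i).length = G.n + 1 := by
  simp [FinGraph.row]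

theorem FinGraph.length_encode (G : FinGraph) : G.encode.length = G.n * (G.n + 1) := by
  simp [FinGraph.encode, List.length_flatten, Function.comp_def, FinGraph.length_row]

/-- Distinct graphs have distinct encodings. -/
theorem FinGraph.encode_injective : Function.Injective FinGraph.encode := by
  intro G H h
  have hl := congrArg List.length h
  rw [FinGraph.length_encode, FinGraph.length_encode] at hl
  have hn : G.n = H.n := by nlinarith
  obtain ⟨n, G⟩ := G
  obtain ⟨m, H⟩ := H
  dsimp at hn
  subst hn
  congr
  have h0 := List.eq_iff_flatten_eq.mpr ⟨h, by simp [FinGraph.length_row, Function.comp_def]⟩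
  ext i j
  have h1 := (List.map_inj_left.mp h0) i (by simp)
  simp only [FinGraph.row, List.append_cancel_right_eq] at h1
  have h2 := (List.map_inj_left.mp h1) j (by simp)
  simpa using h2

/-- A promise problem whose inputs are graphs. -/
structure PromiseProblem where
  /-- The YES instances. -/
  yes : FinGraph → Prop
  /-- The NO instances. -/
  no : FinGraph → Prop

/-- `f` is a polynomial-time (many-one, Karp) reduction from the promise problem `P` to the
promise problem `Q`: it is computed by a multi-tape Turing machine within a number of steps
polynomial in the length of the encoded input, it maps YES instances to YES instances and NO
instances to NO instances. -/
def IsPolyTimeReduction (f : FinGraph → FinGraph) (P Q : PromiseProblem) : Prop :=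
  Nonempty (Turing.TM2ComputableInPolyTime FinGraph.encode FinGraph.encode f) ∧
    (∀ G, P.yes G → Q.yes (f G)) ∧ (∀ G, P.no G → Q.no (f G))

/-- The problem of deciding whether `χ(G) ≤ c₁` or `χ(G) ≥ c₂`. -/
def chromaticGap (c₁ c₂ : ℕ) : PromiseProblem where
  yes G := G.graph.chromaticNumber ≤ c₁
  no G := c₂ ≤ G.graph.chromaticNumber

/-- The problem `IC_A(k, r)` of deciding whether the minimal length of an index code over `A` for
a given graph is at most `k` or at least `r`. -/
def IC (A : Type*) (k : ℕ) (r : ℝ) : PromiseProblem where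
  yes G := indexLength G.graph A ≤ k
  no G := r ≤ indexLength G.graph A

end LineIndex

end

noncomputable section
namespace LineIndex

/-! ### Colourings of a graph from index codes for its line graph, and conversely -/

/-! Let `H` be the complement of the underlying graph of `δG`.

YES side: use the `b k` subsets of size `k / 2` of a `k`-set as colours of `G`. They form an
antichain, so an arc `(x, y)` can be coloured by an element of the set at `x` outside the set at
`y`. On consecutive arcs the middle vertex's set lacks the first colour and contains the second
(`underlyingLine_colorable`). The `k` classes are cliques of `H`, and broadcasting the sum over each
clique is an index code (`exists_isIndexCode_of_colorable_compl`).

NO side: fix a letter `a₀`. Given a code of length `k`, assign to a vertex `v` the set of codewords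
of messages equal to `a₀` off the arcs leaving `v`. Decoding at an arc `(u, v)` shows that adjacent
vertices get different sets, so `χ(G) ≤ 2 ^ (|A| ^ k)` (`colorable_of_isIndexCode`); two logarithms
give the bound.

Computability: an explicit stack machine runs over pairs of ones of the adjacency matrix in cubic
time (`reach_halt`). Its output is the encoding of a graph on the list of arcs (`encode_lineCompl`),
and that graph is isomorphic to `H` (`nonempty_lineCompl_iso`). -/

theorem underlyingLine_adj {V : Type*} (G : SimpleGraph V)
    (e f : {e : V × V // (bidirected G).Adj e.1 e.2}) :
    (underlyingLine G).Adj e f ↔ e ≠ f ∧ (e.1.2 = f.1.1 ∨ f.1.2 = e.1.1) := Iff.rfl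

open Classical in
/-- An index code of length `k` for the complement of the underlying graph of `δG` separates the
vertices of `G` by subsets of the set of codewords. -/
theorem colorable_of_isIndexCode {V A : Type*} [Fintype A] [Nontrivial A]
    (G : SimpleGraph V) {k : ℕ}
    {E : ({e : V × V // (bidirected G).Adj e.1 e.2} → A) → (Fin k → A)}
    (hE : IsIndexCode (underlyingLine G)ᶜ k E) :
    G.Colorable (2 ^ (Fintype.card A ^ k)) := by
  obtain ⟨a₀, a₁, ha⟩ := exists_pair_ne A
  let S : V → Set (Fin k → A) := fun v => E '' {x | ∀ e, x e ≠ a₀ → e.1.1 = v}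
  have hS : ∀ {u v}, G.Adj u v → S u ≠ S v := by
    intro u v huv h
    let e : {e : V × V // (bidirected G).Adj e.1 e.2} := ⟨(u, v), huv⟩
    let x : {e : V × V // (bidirected G).Adj e.1 e.2} → A := fun f => if f = e then a₁ else a₀
    have hx : E x ∈ S u := by
      refine ⟨x, fun f hf => ?_, rfl⟩
      by_cases hfe : f = e
      · rw [hfe]
      · simp [x, hfe] at hf
    rw [h] at hx
    obtain ⟨y, hy, hyx⟩ := hx
    obtain ⟨g, hg⟩ := hE e
    have hside : (fun j : (underlyingLine G)ᶜ.neighborSet e => y j) =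
        fun j : (underlyingLine G)ᶜ.neighborSet e => x j := by
      funext ⟨j, hj⟩
      have hj' : e ≠ j ∧ ¬ (underlyingLine G).Adj e j := by
        simpa [SimpleGraph.compl_adj] using hj
      have hxj : x j = a₀ := by simp [x, Ne.symm hj'.1]
      rw [hxj]
      by_contra hyj
      -- If `y` differs from `a₀` at `j`, then `j` leaves `v`, where `e` ends. So `j` is not a
      -- neighbour of `e` in the complement, and the decoder at `e` sees only `a₀` for both
      -- messages.
      exact hj'.2 ((underlyingLine_adj G e j).2 ⟨hj'.1, Or.inl (hy j hyj).symm⟩)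
    have h1 : y e = x e := by rw [← hg y, ← hg x, hyx, hside]
    have h2 : y e ≠ a₀ := by rw [h1]; simpa [x] using ha.symm
    exact huv.ne (hy e h2)
  have := (SimpleGraph.Coloring.mk S hS).colorable
  simpa [Fintype.card_set] using this

/-- A colouring of `G` by `b k` colours induces a colouring of the underlying graph of `δG` by
`k` colours. -/
theorem underlyingLine_colorable {V : Type*} (G : SimpleGraph V) {k : ℕ}
    (h : G.Colorable (b k)) : (underlyingLine G).Colorable k := by
  classical
  obtain ⟨C⟩ := h
  let φ : Fin (b k) ≃ {s // s ∈ Finset.powersetCard (k / 2) (Finset.univ : Finset (Fin k))} :=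
    Fintype.equivOfCardEq (by
      rw [Fintype.card_coe, Finset.card_powersetCard, Finset.card_univ, Fintype.card_fin,
        Fintype.card_fin, b])
  let s : V → Finset (Fin k) := fun v => (φ (C v)).1
  have hs : ∀ v, (s v).card = k / 2 := fun v => (Finset.mem_powersetCard.1 (φ (C v)).2).2
  have hne : ∀ e : {e : V × V // (bidirected G).Adj e.1 e.2},
      ∃ c, c ∈ s e.1.1 ∧ c ∉ s e.1.2 := by
    intro e
    refine Finset.not_subset.1 fun hsub => ?_
    -- The antichain property: inclusion between sets of equal size is equality, against properness
    -- of `C`.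
    have h1 := Finset.eq_of_subset_of_card_le hsub (by rw [hs, hs])
    exact C.valid (show G.Adj e.1.1 e.1.2 from e.2) (φ.injective (Subtype.ext h1))
  choose c hc hc' using hne
  refine ⟨SimpleGraph.Coloring.mk c ?_⟩
  intro e f hef h
  rcases ((underlyingLine_adj G e f).1 hef).2 with h1 | h1
  · exact hc' e (by rw [h1, h]; exact hc f)
  · exact hc' f (by rw [h1, ← h]; exact hc e)

/-- A colouring of the complement gives an index code: broadcast the sum over every colour
class. -/
theorem exists_isIndexCode_of_colorable_compl {V A : Type*} [Fintype V] [Fintype A] [Nonempty A]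
    (G : SimpleGraph V) {k : ℕ} (h : Gᶜ.Colorable k) :
    ∃ E : (V → A) → (Fin k → A), IsIndexCode G k E := by
  classical
  obtain ⟨C⟩ := h
  have : NeZero (Fintype.card A) := ⟨Fintype.card_ne_zero⟩
  let φ : A ≃ ZMod (Fintype.card A) := Fintype.equivOfCardEq (by rw [ZMod.card])
  refine ⟨fun x c => φ.symm (∑ v with C v = c, φ (x v)), fun i =>
    ⟨fun y z => φ.symm (φ (y (C i)) - ∑ v ∈ (Finset.univ.filter fun v => C v = C i).erase i,
      if hv : G.Adj i v then φ (z ⟨v, hv⟩) else 0), fun x => ?_⟩⟩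
  -- A colour class is a clique of `G`, so the receiver `i` knows all its other members; the default
  -- `0` is never used.
  have hsum : ∀ v ∈ (Finset.univ.filter fun v => C v = C i).erase i,
      (if _hv : G.Adj i v then φ (x v) else 0) = φ (x v) := by
    intro v hv
    simp only [Finset.mem_erase, Finset.mem_filter, Finset.mem_univ, true_and] at hv
    have : G.Adj i v := by
      by_contra hadj
      exact C.valid ((SimpleGraph.compl_adj G i v).2 ⟨hv.1.symm, hadj⟩) hv.2.symm
    simp [this]
  have hi : i ∈ Finset.univ.filter fun v => C v = C i := by simp
  simp only [Equiv.apply_symm_apply]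
  rw [Finset.sum_congr rfl hsum, ← Finset.add_sum_erase _ _ hi]
  simp

theorem IsIndexCode.of_iso {V W A : Type*} {G : SimpleGraph V} {H : SimpleGraph W} (φ : G ≃g H)
    {k : ℕ} {E : (V → A) → (Fin k → A)} (hE : IsIndexCode G k E) :
    IsIndexCode H k (fun x => E (x ∘ φ)) := by
  intro i
  obtain ⟨g, hg⟩ := hE (φ.symm i)
  refine ⟨fun y z => g y fun j => z ⟨φ j, ?_⟩, fun x => ?_⟩
  · have := φ.map_adj_iff.2 (show G.Adj (φ.symm i) j from j.2)
    simpa using this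
  · simpa using hg (x ∘ φ)

theorem IC_yes_of_chromaticGap_yes {V W A : Type*} [Fintype W] [Fintype A] [Nonempty A]
    {G : SimpleGraph V} {H : SimpleGraph W} (φ : H ≃g (underlyingLine G)ᶜ) {k : ℕ}
    (h : G.chromaticNumber ≤ b k) : indexLength H A ≤ k := by
  have h1 := underlyingLine_colorable G (SimpleGraph.chromaticNumber_le_iff_colorable.1 h)
  have h2 : Hᶜ.Colorable k := by
    obtain ⟨C⟩ := h1
    refine ⟨SimpleGraph.Coloring.mk (fun v => C (φ v)) fun {u v} huv => C.valid ?_⟩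
    rw [SimpleGraph.compl_adj] at huv
    have h3 : ¬ (underlyingLine G)ᶜ.Adj (φ u) (φ v) := fun h => huv.2 (φ.map_adj_iff.1 h)
    rw [SimpleGraph.compl_adj] at h3
    by_contra h4
    exact h3 ⟨φ.injective.ne huv.1, h4⟩
  exact Nat.sInf_le (exists_isIndexCode_of_colorable_compl H h2)

theorem IC_no_of_chromaticGap_no {V W A : Type*} [Fintype W] [Fintype A] [Nontrivial A]
    {G : SimpleGraph V} {H : SimpleGraph W} (φ : H ≃g (underlyingLine G)ᶜ) {c : ℕ} (hc : 2 ≤ c)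
    (h : c ≤ G.chromaticNumber) :
    Real.logb (Fintype.card A) (Real.logb 2 c) ≤ indexLength H A := by
  obtain ⟨E, hE⟩ : ∃ E : (W → A) → (Fin (indexLength H A) → A),
      IsIndexCode H (indexLength H A) E := Nat.sInf_mem (s := {k | ∃ E, IsIndexCode H k E})
    ⟨_, exists_isIndexCode H A⟩
  have h1 := (colorable_of_isIndexCode G (hE.of_iso φ)).chromaticNumber_le
  have h2 : c ≤ 2 ^ (Fintype.card A ^ indexLength H A) := by exact_mod_cast h.trans h1
  have hA : (1 : ℝ) < Fintype.card A := by exact_mod_cast Fintype.one_lt_card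
  have hc' : (1 : ℝ) < c := by exact_mod_cast hc
  -- `2 ≤ c` makes the inner logarithm positive, as is needed to undo the outer one.
  rw [Real.logb_le_iff_le_rpow hA (Real.logb_pos (by norm_num) hc'),
    Real.logb_le_iff_le_rpow (by norm_num) (by positivity), Real.rpow_natCast]
  have : ((Fintype.card A : ℝ) ^ indexLength H A) =
    ((Fintype.card A ^ indexLength H A : ℕ) : ℝ) := by push_cast; rfl
  rw [this, Real.rpow_natCast]
  exact_mod_cast h2

end LineIndex
end
noncomputable section
namespace LineIndex

/-! ### A stack machine computing the complement of the line graph -/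

namespace Machine

open Turing Turing.TM2 Function

/-- The letters on the stacks. -/
abbrev Letter := Option Bool

/-- The stacks: the part of the input still to be read by the outer loop, the input matrix for the
inner loop, three unary counters (row, column and position of the entry of the outer loop), the
stacks to which the inner loop moves the matrix and the counters, and the output. -/
inductive Stk
  | todo | mat | matR | row | rowR | col | colR | pos | posR | out
  deriving DecidableEq

instance : Fintype Stk :=
  ⟨{.todo, .mat, .matR, .row, .rowR, .col, .colR, .pos, .posR, .out}, fun k => by cases k <;> decide⟩

/-- The labels of the machine. -/
inductive Lab
  | reverseInput | copyInput | outer | resetCol | innerRow | innerEntry | nextRow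
  | restoreRow | restoreMat | restoreCol | restorePos
  | dropMat | dropRow | dropCol | dropPos
  deriving DecidableEq

instance : Fintype Lab :=
  ⟨{.reverseInput, .copyInput, .outer, .resetCol, .innerRow, .innerEntry, .nextRow,
    .restoreRow, .restoreMat, .restoreCol, .restorePos, .dropMat, .dropRow, .dropCol, .dropPos},
    fun l => by cases l <;> decide⟩

/-- The internal state: the letters popped last, and the outcome of two comparisons. -/
structure Reg where
  /-- the last letter read from the matrix or in a copying loop -/
  letter : Option Letter
  /-- the last letter read from a counter -/
  tick : Option Letter
  /-- whether the row of the inner entry is the column of the outer entry -/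
  rowEqCol : Bool
  /-- whether the inner and the outer entry are the same -/
  samePos : Bool
  deriving Fintype

/-- The state in which the only information is the outcome of the row comparison. -/
def Reg.ofRow (c : Bool) : Reg := ⟨none, none, c, false⟩

/-- The initial state. -/
abbrev Reg.start : Reg := Reg.ofRow false

/-- Programs for the machine. -/
abbrev Code := TM2.Stmt (fun _ : Stk => Letter) Lab Reg

/-- Configurations of the machine. -/
abbrev Conf := TM2.Cfg (fun _ : Stk => Letter) Lab Reg

/-- Push the letter, if there is one. -/
def pushOpt : Option Letter → List Letter → List Letter
  | none, L => L
  | some a, L => a :: L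

/-- The body of a loop labelled `l` that moves the stack `s` to the stack `d`, and goes on
with `q`. -/
def moveLoop (s d : Stk) (l : Lab) (q : Code) : Code :=
  .pop s (fun v a => { v with letter := a }) <|
  .branch (fun v => v.letter.isSome)
    (.push d (fun v => v.letter.getD none) <| .goto fun _ => l)
    (.load (fun _ => .start) q)

/-- The body of a loop labelled `l` that empties the stack `s`, and goes on with `q`. -/
def dropLoop (s : Stk) (l : Lab) (q : Code) : Code :=
  .pop s (fun v a => { v with letter := a }) <|
  .branch (fun v => v.letter.isSome) (.goto fun _ => l) (.load (fun _ => .start) q)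

/-- Move a letter from the counter `s` to `d`. -/
def advance (s d : Stk) (q : Code) : Code :=
  .pop s (fun v a => { v with tick := a }) <|
  .branch (fun v => v.tick.isSome) (.push d (fun v => v.tick.getD none) q) q

/-- The program. -/
def prog : Lab → Code
  | .reverseInput => moveLoop .todo .matR .reverseInput (.goto fun _ => .copyInput)
  | .copyInput =>
    .pop .matR (fun v a => { v with letter := a }) <|
    .branch (fun v => v.letter.isSome)
      (.push .todo (fun v => v.letter.getD none) <| .push .mat (fun v => v.letter.getD none) <|
        .goto fun _ => .copyInput)
      (.load (fun _ => .start) <| .push .row (fun _ => some true) <|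
        .push .col (fun _ => some true) <| .push .pos (fun _ => some true) <|
        .goto fun _ => .outer)
  | .outer =>
    .pop .todo (fun v a => { v with letter := a }) <|
    .branch (fun v => v.letter.isSome)
      (.branch (fun v => v.letter = some none)
        (.load (fun _ => .start) <| .push .row (fun _ => some false) <|
          .push .pos (fun _ => some false) <| .goto fun _ => .resetCol)
        (.branch (fun v => v.letter = some (some true))
          (.load (fun _ => .start) <| .push .out (fun _ => none) <| .goto fun _ => .innerRow)
          (.load (fun _ => .start) <| .push .col (fun _ => some false) <|
            .push .pos (fun _ => some false) <| .goto fun _ => .outer)))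
      (.load (fun _ => .start) <| .goto fun _ => .dropMat)
  | .resetCol =>
    dropLoop .col .resetCol (.push .col (fun _ => some true) <| .goto fun _ => .outer)
  | .innerRow =>
    advance .col .colR <| .load (fun v => .ofRow (v.tick = some (some true))) <|
      .goto fun _ => .innerEntry
  | .innerEntry =>
    .pop .mat (fun v a => { v with letter := a }) <|
    .branch (fun v => v.letter.isSome)
      (.push .matR (fun v => v.letter.getD none) <| advance .pos .posR <|
        .load (fun v => { v with samePos := v.tick = some (some true) }) <|
        .branch (fun v => v.letter = some none)
          (.load (fun _ => .start) <| .goto fun _ => .nextRow)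
          (advance .row .rowR <| .branch (fun v => v.letter = some (some true))
            (.push .out
                (fun v => some (!(v.rowEqCol || v.tick = some (some true) || v.samePos))) <|
              .load (fun v => .ofRow v.rowEqCol) <| .goto fun _ => .innerEntry)
            (.load (fun v => .ofRow v.rowEqCol) <| .goto fun _ => .innerEntry)))
      (.load (fun _ => .start) <| .goto fun _ => .restoreRow)
  | .nextRow => moveLoop .rowR .row .nextRow (.goto fun _ => .innerRow)
  | .restoreRow => moveLoop .rowR .row .restoreRow (.goto fun _ => .restoreMat)
  | .restoreMat => moveLoop .matR .mat .restoreMat (.goto fun _ => .restoreCol)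
  | .restoreCol => moveLoop .colR .col .restoreCol (.goto fun _ => .restorePos)
  | .restorePos => moveLoop .posR .pos .restorePos
      (.push .col (fun _ => some false) <| .push .pos (fun _ => some false) <|
        .goto fun _ => .outer)
  | .dropMat => dropLoop .mat .dropMat (.goto fun _ => .dropRow)
  | .dropRow => dropLoop .row .dropRow (.goto fun _ => .dropCol)
  | .dropCol => dropLoop .col .dropCol (.goto fun _ => .dropPos)
  | .dropPos => dropLoop .pos .dropPos .halt

/-- The contents of the stacks, as a function of the stack. -/
def stk (todo mat matR row rowR col colR pos posR out : List Letter) : Stk → List Letter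
  | .todo => todo | .mat => mat | .matR => matR | .row => row | .rowR => rowR
  | .col => col | .colR => colR | .pos => pos | .posR => posR | .out => out

section stk

variable (x m mr r rr c cr p pr o l : List Letter)

@[simp] theorem update_todo : update (stk x m mr r rr c cr p pr o) .todo l =
    stk l m mr r rr c cr p pr o := by funext k; cases k <;> rfl
@[simp] theorem update_mat : update (stk x m mr r rr c cr p pr o) .mat l =
    stk x l mr r rr c cr p pr o := by funext k; cases k <;> rfl
@[simp] theorem update_matR : update (stk x m mr r rr c cr p pr o) .matR l =
    stk x m l r rr c cr p pr o := by funext k; cases k <;> rfl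
@[simp] theorem update_row : update (stk x m mr r rr c cr p pr o) .row l =
    stk x m mr l rr c cr p pr o := by funext k; cases k <;> rfl
@[simp] theorem update_rowR : update (stk x m mr r rr c cr p pr o) .rowR l =
    stk x m mr r l c cr p pr o := by funext k; cases k <;> rfl
@[simp] theorem update_col : update (stk x m mr r rr c cr p pr o) .col l =
    stk x m mr r rr l cr p pr o := by funext k; cases k <;> rfl
@[simp] theorem update_colR : update (stk x m mr r rr c cr p pr o) .colR l =
    stk x m mr r rr c l p pr o := by funext k; cases k <;> rfl
@[simp] theorem update_pos : update (stk x m mr r rr c cr p pr o) .pos l =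
    stk x m mr r rr c cr l pr o := by funext k; cases k <;> rfl
@[simp] theorem update_posR : update (stk x m mr r rr c cr p pr o) .posR l =
    stk x m mr r rr c cr p l o := by funext k; cases k <;> rfl
@[simp] theorem update_out : update (stk x m mr r rr c cr p pr o) .out l =
    stk x m mr r rr c cr p pr l := by funext k; cases k <;> rfl

@[simp] theorem stk_todo : stk x m mr r rr c cr p pr o .todo = x := rfl
@[simp] theorem stk_mat : stk x m mr r rr c cr p pr o .mat = m := rfl
@[simp] theorem stk_matR : stk x m mr r rr c cr p pr o .matR = mr := rfl
@[simp] theorem stk_row : stk x m mr r rr c cr p pr o .row = r := rfl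
@[simp] theorem stk_rowR : stk x m mr r rr c cr p pr o .rowR = rr := rfl
@[simp] theorem stk_col : stk x m mr r rr c cr p pr o .col = c := rfl
@[simp] theorem stk_colR : stk x m mr r rr c cr p pr o .colR = cr := rfl
@[simp] theorem stk_pos : stk x m mr r rr c cr p pr o .pos = p := rfl
@[simp] theorem stk_posR : stk x m mr r rr c cr p pr o .posR = pr := rfl
@[simp] theorem stk_out : stk x m mr r rr c cr p pr o .out = o := rfl

end stk

/-! #### Runs of bounded length -/

/-- The machine passes from `c` to `d` within `t` steps. -/
def Reach (c d : Conf) (t : ℕ) : Prop :=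
  ∃ s ≤ t, (flip bind (TM2.step prog))^[s] (some c) = some d

theorem Reach.trans {c d e : Conf} {t u : ℕ} (h : Reach c d t) (h' : Reach d e u) :
    Reach c e (t + u) := by
  obtain ⟨s, hs, h⟩ := h
  obtain ⟨s', hs', h'⟩ := h'
  exact ⟨s' + s, by omega, by rw [Function.iterate_add_apply, h, h']⟩

theorem Reach.mono {c d : Conf} {t u : ℕ} (h : Reach c d t) (htu : t ≤ u) : Reach c d u :=
  let ⟨s, hs, h⟩ := h; ⟨s, hs.trans htu, h⟩

theorem Reach.single {l : Lab} {v : Reg} {S : Stk → List Letter} {d : Conf}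
    (h : stepAux (prog l) v S = d) : Reach ⟨some l, v, S⟩ d 1 :=
  ⟨1, le_rfl, by subst h; rfl⟩

theorem Reach.head {l : Lab} {v : Reg} {S : Stk → List Letter} {d e : Conf} {t : ℕ}
    (h : stepAux (prog l) v S = d) (h' : Reach d e t) : Reach ⟨some l, v, S⟩ e (t + 1) :=
  ((Reach.single h).trans h').mono (by omega)

/-- A loop that moves a stack. -/
theorem reach_moveLoop {s d : Stk} (hsd : s ≠ d) {l : Lab} {q : Code}
    (hl : prog l = moveLoop s d l q) (L : List Letter) (v : Reg) (S : Stk → List Letter)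
    (hS : S s = L) :
    Reach ⟨some l, v, S⟩ (stepAux q .start (update (update S s []) d (L.reverse ++ S d)))
      (L.length + 1) := by
  induction L generalizing v S with
  | nil =>
    have : update (update S s []) d (S d) = update S s [] := by
      rw [Function.update_eq_self_iff, Function.update_of_ne hsd.symm]
    refine Reach.single ?_
    simp [hl, moveLoop, hS, this]
  | cons a L ih =>
    refine Reach.head (d := ⟨some l, { v with letter := some a },
      update (update S s L) d (a :: S d)⟩) ?_ ?_
    · simp [hl, moveLoop, hS, Function.update_of_ne hsd.symm]
    · have e : update (update S s []) d ((a :: L).reverse ++ S d) =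
          update (update (update (update S s L) d (a :: S d)) s []) d (L.reverse ++ a :: S d) := by
        funext k
        by_cases hk : k = d
        · subst hk; simp
        · by_cases hk' : k = s
          · subst hk'; simp [hk]
          · simp [hk, hk']
      have h := ih { v with letter := some a } (update (update S s L) d (a :: S d)) (by
        simp [Function.update_of_ne hsd])
      rw [Function.update_self] at h
      rw [e]
      exact h

/-- A loop that empties a stack. -/
theorem reach_dropLoop {s : Stk} {l : Lab} {q : Code}
    (hl : prog l = dropLoop s l q) (L : List Letter) (v : Reg) (S : Stk → List Letter)
    (hS : S s = L) :
    Reach ⟨some l, v, S⟩ (stepAux q .start (update S s [])) (L.length + 1) := by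
  induction L generalizing v S with
  | nil =>
    refine Reach.single ?_
    simp [hl, dropLoop, hS]
  | cons a L ih =>
    refine Reach.head (d := ⟨some l, { v with letter := some a }, update S s L⟩) ?_ ?_
    · simp [hl, dropLoop, hS]
    · simpa using ih { v with letter := some a } (update S s L) (by simp)

theorem stepAux_advance {s d : Stk} (hsd : s ≠ d) (q : Code) (v : Reg) (S : Stk → List Letter) :
    stepAux (advance s d q) v S = stepAux q { v with tick := (S s).head? }
      (update (update S s (S s).tail) d (pushOpt (S s).head? (S d))) := by
  cases h : S s with
  | nil =>
    have : update (update S s []) d (S d) = update S s [] := by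
      rw [Function.update_eq_self_iff, Function.update_of_ne hsd.symm]
    simp [advance, h, pushOpt, this]
  | cons a L => simp [advance, h, pushOpt, Function.update_of_ne hsd.symm]

/-! #### Counters -/

/-- The counter with value `n`. -/
def counter (n : ℕ) : List Letter := List.replicate n (some false) ++ [some true]

@[simp] theorem length_counter (n : ℕ) : (counter n).length = n + 1 := by simp [counter]

theorem counter_succ (n : ℕ) : counter (n + 1) = some false :: counter n := rfl

/-- The only `some true` is at the bottom, so a single pop after `l` moves tests `l = n`. -/
theorem counter_getElem? (n l : ℕ) : (counter n)[l]? = some (some true) ↔ l = n := by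
  rw [counter, List.getElem?_append]
  by_cases h : l < n
  · simp [h, h.ne]
  · have : l - n = 0 ↔ l = n := by omega
    cases h' : l - n with
    | zero => simp [this.1 h']
    | succ k => simp [h, h']; omega

/-- The letters of `L` moved to the auxiliary stack after `l` moves. -/
def moved (L : List Letter) (l : ℕ) : List Letter := (L.take l).reverse

/-- Holds past the end of `L` too: both sides stay put, just as `advance` does on an empty stack.
The loops may therefore overrun a counter without harm. -/
theorem moved_succ (L : List Letter) (l : ℕ) : moved L (l + 1) = pushOpt L[l]? (moved L l) := by
  rw [moved, moved, List.take_add_one]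
  cases L[l]? <;> simp [pushOpt]

theorem moved_zero (L : List Letter) : moved L 0 = [] := by simp [moved]

theorem reverse_moved_append_drop (L : List Letter) (l : ℕ) :
    (moved L l).reverse ++ L.drop l = L := by simp [moved]

theorem length_moved_le (L : List Letter) (l : ℕ) : (moved L l).length ≤ L.length := by
  simp [moved]

/-! #### The inner loop -/

/-- The output for the inner loop when the entry of the outer loop is at row `i`, column `j` and
position `p`, started with the remaining entries `m` in row `k`, column `l` and position `q`. -/
def bits (i j p : ℕ) : ℕ → ℕ → ℕ → List Letter → List Letter
  | _, _, _, [] => []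
  | k, _, q, none :: m => bits i j p (k + 1) 0 (q + 1) m
  | k, l, q, some false :: m => bits i j p k (l + 1) (q + 1) m
  | k, l, q, some true :: m =>
    some (!(decide (k = j) || decide (l = i) || decide (q = p))) :: bits i j p k (l + 1) (q + 1) m

/-- The counters are used crosswise: the outer column `j` is consumed by inner rows and the outer
row `i` by inner columns, because adjacency compares the head of one arc with the tail of the other.
-/
theorem reach_innerRow (i j p k l q : ℕ) (x m mr o : List Letter) :
    Reach ⟨some .innerRow, .start, stk x m mr ((counter i).drop l) (moved (counter i) l)
        ((counter j).drop k) (moved (counter j) k) ((counter p).drop q) (moved (counter p) q) o⟩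
      ⟨some .innerEntry, .ofRow (k = j),
        stk x m mr ((counter i).drop l) (moved (counter i) l)
        ((counter j).drop (k + 1)) (moved (counter j) (k + 1))
        ((counter p).drop q) (moved (counter p) q) o⟩ 1 := by
  refine Reach.single ?_
  rw [prog, stepAux_advance (by decide)]
  simp [moved_succ, counter_getElem?]

/-- The final `k'`, `l'`, `q'` are left unspecified since any `moved` and `drop` parts reassemble to
the whole counter. The factor `i + 5` pays for a row separator, which resets the row counter of
length `i + 1`; other letters take one step. -/
theorem reach_inner (i j p : ℕ) (x m mr o : List Letter) (k l q : ℕ) :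
    ∃ k' l' q', Reach ⟨some .innerEntry, .ofRow (k = j),
        stk x m mr ((counter i).drop l) (moved (counter i) l)
        ((counter j).drop (k + 1)) (moved (counter j) (k + 1))
        ((counter p).drop q) (moved (counter p) q) o⟩
      ⟨some .restoreRow, .start,
        stk x [] (m.reverse ++ mr) ((counter i).drop l') (moved (counter i) l')
        ((counter j).drop k') (moved (counter j) k')
        ((counter p).drop q') (moved (counter p) q') ((bits i j p k l q m).reverse ++ o)⟩
      (m.length * (i + 5) + 1) := by
  induction m generalizing mr o k l q with
  | nil =>
    exact ⟨k + 1, l, q, (Reach.single (by simp [prog, bits])).mono (by simp)⟩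
  | cons a m ih =>
    match a with
    | none =>
      obtain ⟨k', l', q', h⟩ := ih (none :: mr) o (k + 1) 0 (q + 1)
      refine ⟨k', l', q', ?_⟩
      have h1 : Reach ⟨some .innerEntry, .ofRow (k = j),
          stk x (none :: m) mr ((counter i).drop l) (moved (counter i) l)
          ((counter j).drop (k + 1)) (moved (counter j) (k + 1))
          ((counter p).drop q) (moved (counter p) q) o⟩
        ⟨some .nextRow, .start,
          stk x m (none :: mr) ((counter i).drop l) (moved (counter i) l)
          ((counter j).drop (k + 1)) (moved (counter j) (k + 1))
          ((counter p).drop (q + 1)) (moved (counter p) (q + 1)) o⟩ 1 := by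
        refine Reach.single ?_
        simp [prog, stepAux_advance, moved_succ]
      have h2 := reach_moveLoop (s := .rowR) (d := .row) (l := .nextRow) (by decide) rfl _ .start
        (stk x m (none :: mr) ((counter i).drop l) (moved (counter i) l)
          ((counter j).drop (k + 1)) (moved (counter j) (k + 1))
          ((counter p).drop (q + 1)) (moved (counter p) (q + 1)) o) rfl
      simp only [update_rowR, update_row, stk_row, stk_rowR, stepAux,
        reverse_moved_append_drop] at h2
      have h3 := reach_innerRow i j p (k + 1) 0 (q + 1) x m (none :: mr) o
      simp only [moved_zero, List.drop_zero] at h3 h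
      have := ((h1.trans h2).trans h3).trans h
      have hlen := length_moved_le (counter i) l
      simp only [length_counter] at hlen
      simp only [List.reverse_cons, List.append_assoc, List.singleton_append, bits,
        List.length_cons]
      refine this.mono ?_
      rw [add_mul]
      omega
    | some false =>
      obtain ⟨k', l', q', h⟩ := ih (some false :: mr) o k (l + 1) (q + 1)
      refine ⟨k', l', q', ?_⟩
      simp only [List.reverse_cons, List.append_assoc, List.singleton_append, bits,
        List.length_cons]
      refine (Reach.head ?_ h).mono (by rw [add_mul]; omega)
      simp [prog, stepAux_advance, moved_succ, Reg.ofRow]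
    | some true =>
      obtain ⟨k', l', q', h⟩ := ih (some true :: mr)
        (some (!(decide (k = j) || decide (l = i) || decide (q = p))) :: o) k (l + 1) (q + 1)
      refine ⟨k', l', q', ?_⟩
      simp only [List.reverse_cons, List.append_assoc, List.singleton_append, bits,
        List.length_cons]
      refine (Reach.head ?_ h).mono (by rw [add_mul]; omega)
      simp [prog, stepAux_advance, moved_succ, Reg.ofRow, counter_getElem?]

/-- The inner loop together with the restoration of the stacks. -/
theorem reach_restored (i j p : ℕ) (x m o : List Letter) :
    Reach ⟨some .innerRow, .start,
        stk x m [] (counter i) [] (counter j) [] (counter p) [] o⟩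
      ⟨some .outer, .start, stk x m [] (counter i) [] (counter (j + 1)) [] (counter (p + 1)) []
        ((bits i j p 0 0 0 m).reverse ++ o)⟩
      (m.length * (i + 6) + i + j + p + 12) := by
  have h0 := reach_innerRow i j p 0 0 0 x m [] o
  obtain ⟨k, l, q, h1⟩ := reach_inner i j p x m [] o 0 0 0
  simp only [moved_zero, List.drop_zero] at h0 h1
  set o' := (bits i j p 0 0 0 m).reverse ++ o
  have h2 := reach_moveLoop (s := .rowR) (d := .row) (l := .restoreRow) (by decide) rfl _ .start
    (stk x [] (m.reverse ++ []) ((counter i).drop l) (moved (counter i) l)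
      ((counter j).drop k) (moved (counter j) k)
      ((counter p).drop q) (moved (counter p) q) o') rfl
  simp only [update_rowR, update_row, stk_row, stk_rowR, stepAux,
    reverse_moved_append_drop] at h2
  have h3 := reach_moveLoop (s := .matR) (d := .mat) (l := .restoreMat) (by decide) rfl _ .start
    (stk x [] (m.reverse ++ []) (counter i) []
      ((counter j).drop k) (moved (counter j) k)
      ((counter p).drop q) (moved (counter p) q) o') rfl
  simp only [update_matR, update_mat, stk_mat, stk_matR, stepAux, List.append_nil,
    List.reverse_reverse] at h3
  have h4 := reach_moveLoop (s := .colR) (d := .col) (l := .restoreCol) (by decide) rfl _ .start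
    (stk x m [] (counter i) [] ((counter j).drop k) (moved (counter j) k)
      ((counter p).drop q) (moved (counter p) q) o') rfl
  simp only [update_colR, update_col, stk_col, stk_colR, stepAux,
    reverse_moved_append_drop] at h4
  have h5 := reach_moveLoop (s := .posR) (d := .pos) (l := .restorePos) (by decide) rfl _ .start
    (stk x m [] (counter i) [] (counter j) [] ((counter p).drop q) (moved (counter p) q) o') rfl
  simp only [update_posR, update_pos, stk_pos, stk_posR, stepAux, update_col, stk_col,
    reverse_moved_append_drop, ← counter_succ] at h5
  rw [List.append_nil] at h1 h2
  refine (((((h0.trans h1).trans h2).trans h3).trans h4).trans h5).mono ?_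
  have e1 := length_moved_le (counter i) l
  have e2 := length_moved_le (counter j) k
  have e3 := length_moved_le (counter p) q
  simp only [length_counter] at e1 e2 e3
  have e4 : m.length * (i + 6) = m.length * (i + 5) + m.length := by ring
  simp only [List.length_reverse]
  omega

/-! #### The outer loop -/

/-- The output for the remaining entries of the outer loop, started in row `i`, column `j` and
position `p`. -/
def rows (m : List Letter) : ℕ → ℕ → ℕ → List Letter → List Letter
  | _, _, _, [] => []
  | i, _, p, none :: x => rows m (i + 1) 0 (p + 1) x
  | i, j, p, some false :: x => rows m i (j + 1) (p + 1) x
  | i, j, p, some true :: x => none :: (bits i j p 0 0 0 m ++ rows m i (j + 1) (p + 1) x)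

/-- Each counter grows by at most one per letter, so one bound `B` covers all three and gives a
uniform cost per letter. -/
theorem reach_outer (m x o : List Letter) (i j p B : ℕ) (hi : i + x.length ≤ B)
    (hj : j + x.length ≤ B) (hp : p + x.length ≤ B) :
    ∃ i' j' p', i' ≤ B ∧ j' ≤ B ∧ p' ≤ B ∧ Reach
      ⟨some .outer, .start, stk x m [] (counter i) [] (counter j) [] (counter p) [] o⟩
      ⟨some .dropMat, .start, stk [] m [] (counter i') [] (counter j') [] (counter p') []
        ((rows m i j p x).reverse ++ o)⟩
      (x.length * (m.length * (B + 6) + 3 * B + 13) + 1) := by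
  induction x generalizing o i j p with
  | nil =>
    exact ⟨i, j, p, by simpa using hi, by simpa using hj, by simpa using hp,
      (Reach.single (by simp [prog, rows])).mono (by simp)⟩
  | cons a x ih =>
    simp only [List.length_cons] at hi hj hp
    match a with
    | none =>
      obtain ⟨i', j', p', hi', hj', hp', h⟩ := ih o (i + 1) 0 (p + 1) (by omega) (by omega)
        (by omega)
      refine ⟨i', j', p', hi', hj', hp', ?_⟩
      have h1 := reach_dropLoop (s := .col) (l := .resetCol) rfl _ .start
        (stk x m [] (counter (i + 1)) [] (counter j) [] (counter (p + 1)) [] o) rfl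
      simp only [update_col, stk_col, stepAux] at h1
      simp only [rows, List.length_cons]
      refine (Reach.head (d := ⟨some .resetCol, .start,
        stk x m [] (counter (i + 1)) [] (counter j) [] (counter (p + 1)) [] o⟩) ?_
        (h1.trans h)).mono ?_
      · simp [prog, counter_succ]
      · simp only [length_counter, add_mul]
        omega
    | some false =>
      obtain ⟨i', j', p', hi', hj', hp', h⟩ := ih o i (j + 1) (p + 1) (by omega) (by omega)
        (by omega)
      refine ⟨i', j', p', hi', hj', hp', ?_⟩
      simp only [rows, List.length_cons]
      refine (Reach.head ?_ h).mono (by rw [add_mul]; omega)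
      simp [prog, counter_succ]
    | some true =>
      obtain ⟨i', j', p', hi', hj', hp', h⟩ := ih ((bits i j p 0 0 0 m).reverse ++ none :: o)
        i (j + 1) (p + 1) (by omega) (by omega) (by omega)
      refine ⟨i', j', p', hi', hj', hp', ?_⟩
      have h1 := reach_restored i j p x m (none :: o)
      simp only [rows, List.length_cons, List.reverse_cons, List.reverse_append,
        List.append_assoc, List.singleton_append]
      refine (Reach.head ?_ (h1.trans h)).mono ?_
      · simp [prog]
      · have : m.length * (i + 6) ≤ m.length * (B + 6) := by gcongr; omega
        rw [add_mul]
        omega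

/-! #### The complete run -/

/-- The input has been reversed onto `matR`; popping it restores the order in two copies, one for
each loop. -/
theorem reach_copyInput (m x y : List Letter) (v : Reg) :
    Reach ⟨some .copyInput, v, stk x y m [] [] [] [] [] [] []⟩
      ⟨some .outer, .start, stk (m.reverse ++ x) (m.reverse ++ y) [] (counter 0) []
        (counter 0) [] (counter 0) [] []⟩ (m.length + 1) := by
  induction m generalizing x y v with
  | nil => exact Reach.single (by simp [prog, counter])
  | cons a m ih =>
    simp only [List.reverse_cons, List.append_assoc, List.singleton_append]
    exact Reach.head (by simp [prog]) (ih (a :: x) (a :: y) { v with letter := some a })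

/-- The last four loops are needed because a halting configuration must have every stack but the
output empty. -/
theorem reach_halt (x : List Letter) :
    Reach ⟨some .reverseInput, .start, stk x [] [] [] [] [] [] [] [] []⟩
      ⟨none, .start, stk [] [] [] [] [] [] [] [] [] (rows x 0 0 0 x).reverse⟩
      ((x.length + 10) ^ 3) := by
  have h1 := reach_moveLoop (s := .todo) (d := .matR) (l := .reverseInput) (by decide) rfl _ .start
    (stk x [] [] [] [] [] [] [] [] []) rfl
  simp only [update_todo, update_matR, stk_todo, stk_matR, stepAux, List.append_nil] at h1
  have h2 := reach_copyInput x.reverse [] [] .start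
  simp only [List.reverse_reverse, List.append_nil] at h2
  obtain ⟨i, j, p, hi, hj, hp, h3⟩ := reach_outer x x [] 0 0 0 x.length (by simp) (by simp)
    (by simp)
  rw [List.append_nil] at h3
  set o := (rows x 0 0 0 x).reverse
  have h4 := reach_dropLoop (s := .mat) (l := .dropMat) rfl _ .start
    (stk [] x [] (counter i) [] (counter j) [] (counter p) [] o) rfl
  have h5 := reach_dropLoop (s := .row) (l := .dropRow) rfl _ .start
    (stk [] [] [] (counter i) [] (counter j) [] (counter p) [] o) rfl
  have h6 := reach_dropLoop (s := .col) (l := .dropCol) rfl _ .start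
    (stk [] [] [] [] [] (counter j) [] (counter p) [] o) rfl
  have h7 := reach_dropLoop (s := .pos) (l := .dropPos) rfl _ .start
    (stk [] [] [] [] [] [] [] (counter p) [] o) rfl
  simp only [update_mat, update_row, update_col, update_pos, stk_mat, stk_row, stk_col, stk_pos,
    stepAux, length_counter] at h4 h5 h6 h7
  refine ((((((h1.trans h2).trans h3).trans h4).trans h5).trans h6).trans h7).mono ?_
  simp only [List.length_reverse]
  nlinarith [Nat.zero_le (x.length ^ 2)]

/-- The machine, with its finiteness data. -/
def machine : FinTM2 where
  K := Stk
  k₀ := .todo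
  k₁ := .out
  Γ := fun _ => Letter
  Λ := Lab
  main := .reverseInput
  σ := Reg
  initialState := .start
  Γk₀Fin := inferInstanceAs (Fintype Letter)
  m := prog

theorem initList_machine (x : List Letter) :
    initList machine x = (⟨some .reverseInput, .start, stk x [] [] [] [] [] [] [] [] []⟩ : Conf) := by
  have : (initList machine x).stk = stk x [] [] [] [] [] [] [] [] [] := by
    funext k; cases k <;> rfl
  exact congrArg (fun S => (⟨some .reverseInput, .start, S⟩ : Conf)) this

theorem haltList_machine (x : List Letter) :
    haltList machine x = (⟨none, .start, stk [] [] [] [] [] [] [] [] [] x⟩ : Conf) := by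
  have : (haltList machine x).stk = stk [] [] [] [] [] [] [] [] [] x := by
    funext k; cases k <;> rfl
  exact congrArg (fun S => (⟨none, .start, S⟩ : Conf)) this

/-- A function on encoded objects that is computed by `rows` is computable in polynomial time. -/
theorem nonempty_computable {α : Type} (enc : α → List Letter) (f : α → α)
    (hf : ∀ a, enc (f a) = (rows (enc a) 0 0 0 (enc a)).reverse) :
    Nonempty (TM2ComputableInPolyTime enc enc f) := by
  refine ⟨{ tm := machine
            inputAlphabet := Equiv.refl _
            outputAlphabet := Equiv.refl _
            time := (Polynomial.X + 10) ^ 3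
            outputsFun := fun a => ?_ }⟩
  have h := reach_halt (enc a)
  rw [← hf, ← initList_machine, ← haltList_machine] at h
  refine Classical.choice ?_
  obtain ⟨s, hs, h⟩ := h
  have e : ∀ L : List Letter, L.map (Equiv.refl Letter).invFun = L := fun L => List.map_id L
  refine ⟨⟨⟨s, ?_⟩, ?_⟩⟩
  · erw [e, e]
    exact h
  · simpa using hs

end Machine

end LineIndex
end
noncomputable section
namespace LineIndex

/-! ### The reduction -/

open Machine

/-- The entries `1` of a matrix, each with its row, its column and its position in the encoding,
when the first letter is in row `k`, column `l` and position `q`. -/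
def entries : ℕ → ℕ → ℕ → List Letter → List (ℕ × ℕ × ℕ)
  | _, _, _, [] => []
  | k, _, q, none :: m => entries (k + 1) 0 (q + 1) m
  | k, l, q, some false :: m => entries k (l + 1) (q + 1) m
  | k, l, q, some true :: m => (k, l, q) :: entries k (l + 1) (q + 1) m

/-- The entry of the adjacency matrix of the complement of the underlying graph of `δG` for two
arcs given by their row, column and position. -/
def lineEntry (e f : ℕ × ℕ × ℕ) : Letter :=
  some (!(decide (f.1 = e.2.1) || decide (f.2.1 = e.1) || decide (f.2.2 = e.2.2)))

theorem bits_eq_map (e : ℕ × ℕ × ℕ) (m : List Letter) (k l q : ℕ) :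
    bits e.1 e.2.1 e.2.2 k l q m = (entries k l q m).map (lineEntry e) := by
  induction m generalizing k l q with
  | nil => rfl
  | cons a m ih =>
    match a with
    | none => exact ih _ _ _
    | some false => exact ih _ _ _
    | some true => exact congrArg _ (ih _ _ _)

theorem rows_eq_flatMap (m x : List Letter) (i j p : ℕ) :
    rows m i j p x =
      (entries i j p x).flatMap fun e => none :: (entries 0 0 0 m).map (lineEntry e) := by
  induction x generalizing i j p with
  | nil => rfl
  | cons a x ih =>
    match a with
    | none => exact ih _ _ _
    | some false => exact ih _ _ _
    | some true =>
      rw [rows, entries, List.flatMap_cons, ih, ← bits_eq_map, List.cons_append]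

theorem le_of_mem_entries {m : List Letter} {k l q : ℕ} {e : ℕ × ℕ × ℕ}
    (h : e ∈ entries k l q m) : q ≤ e.2.2 := by
  induction m generalizing k l q with
  | nil => simp [entries] at h
  | cons a m ih =>
    match a with
    | none => exact (Nat.le_succ q).trans (ih h)
    | some false => exact (Nat.le_succ q).trans (ih h)
    | some true =>
      rw [entries, List.mem_cons] at h
      rcases h with rfl | h
      · exact le_rfl
      · exact (Nat.le_succ q).trans (ih h)

/-- The position increases with every letter, so no later entry repeats an earlier one. -/
theorem nodup_entries (m : List Letter) (k l q : ℕ) : (entries k l q m).Nodup := by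
  induction m generalizing k l q with
  | nil => exact List.nodup_nil
  | cons a m ih =>
    match a with
    | none => exact ih _ _ _
    | some false => exact ih _ _ _
    | some true =>
      exact List.nodup_cons.2 ⟨fun h => absurd (le_of_mem_entries h) (by simp), ih _ _ _⟩

theorem mem_entries_row (a : ℕ → Bool) (m : List Letter) (e : ℕ × ℕ × ℕ) (k l q t : ℕ) :
    e ∈ entries k l q ((List.range' l t).map (fun c => some (a c)) ++ none :: m) ↔
      (e.1 = k ∧ l ≤ e.2.1 ∧ e.2.1 < l + t ∧ a e.2.1 = true ∧ e.2.2 + l = q + e.2.1) ∨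
        e ∈ entries (k + 1) 0 (q + t + 1) m := by
  induction t generalizing l q with
  | zero =>
    simp only [List.range'_zero, List.map_nil, List.nil_append, entries, add_zero]
    constructor
    · exact Or.inr
    · rintro (h | h)
      · omega
      · exact h
  | succ t ih =>
    rw [List.range'_succ, List.map_cons, List.cons_append]
    have e1 : q + 1 + t + 1 = q + (t + 1) + 1 := by ring
    obtain ⟨r, c, s⟩ := e
    cases ha : a l with
    | false =>
      rw [entries, ih, e1]
      refine or_congr_left ?_
      constructor
      · rintro ⟨h1, h2, h3, h4, h5⟩
        exact ⟨h1, by omega, by omega, h4, by omega⟩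
      · rintro ⟨h1, h2, h3, h4, h5⟩
        have : c ≠ l := by rintro rfl; simp [ha] at h4
        dsimp only at *
        exact ⟨h1, by omega, by omega, h4, by omega⟩
    | true =>
      rw [entries, List.mem_cons, ih, e1, ← or_assoc]
      refine or_congr_left ?_
      simp only [Prod.mk.injEq]
      constructor
      · rintro (⟨rfl, rfl, rfl⟩ | ⟨h1, h2, h3, h4, h5⟩)
        · exact ⟨rfl, le_rfl, by omega, ha, rfl⟩
        · exact ⟨h1, by omega, by omega, h4, by omega⟩
      · rintro ⟨h1, h2, h3, h4, h5⟩
        by_cases hc : c = l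
        · exact Or.inl ⟨h1, hc, by omega⟩
        · exact Or.inr ⟨h1, by omega, by omega, h4, by omega⟩

/-- A row occupies `n + 1` letters with its separator, which gives the position; the equation is
additive to avoid truncated subtraction. -/
theorem mem_entries_matrix (a : ℕ → ℕ → Bool) (n : ℕ) (e : ℕ × ℕ × ℕ) (k q t : ℕ) :
    e ∈ entries k 0 q ((List.range' k t).map
        (fun r => (List.range' 0 n).map (fun c => some (a r c)) ++ [none])).flatten ↔
      k ≤ e.1 ∧ e.1 < k + t ∧ e.2.1 < n ∧ a e.1 e.2.1 = true ∧
        e.2.2 + k * (n + 1) = q + e.1 * (n + 1) + e.2.1 := by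
  induction t generalizing k q with
  | zero =>
    simp only [List.range'_zero, List.map_nil, List.flatten_nil, entries, List.not_mem_nil,
      false_iff]
    omega
  | succ t ih =>
    rw [List.range'_succ, List.map_cons, List.flatten_cons, List.append_assoc,
      List.singleton_append, mem_entries_row, ih]
    obtain ⟨r, c, s⟩ := e
    dsimp only
    have e1 : (k + 1) * (n + 1) = k * (n + 1) + (n + 1) := by ring
    rw [e1]
    constructor
    · rintro (⟨rfl, h2, h3, h4, h5⟩ | ⟨h1, h2, h3, h4, h5⟩)
      · exact ⟨le_rfl, by omega, by omega, h4, by omega⟩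
      · exact ⟨by omega, by omega, h3, h4, by omega⟩
    · rintro ⟨h1, h2, h3, h4, h5⟩
      by_cases hr : r = k
      · subst hr
        exact Or.inl ⟨rfl, by omega, by omega, h4, by omega⟩
      · exact Or.inr ⟨by omega, by omega, h3, h4, by omega⟩

open Classical in
theorem FinGraph.encode_eq_range' (G : FinGraph) :
    G.encode = ((List.range' 0 G.n).map fun r => (List.range' 0 G.n).map (fun c =>
      some (decide (∃ (hr : r < G.n) (hc : c < G.n), G.graph.Adj ⟨r, hr⟩ ⟨c, hc⟩))) ++
        [none]).flatten := by
  have h : List.range' 0 G.n = (List.finRange G.n).map (↑) := by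
    rw [List.map_coe_finRange_eq_range, List.range_eq_range']
  rw [FinGraph.encode, h, List.map_map]
  congr 1
  refine List.map_congr_left fun r _ => ?_
  simp [FinGraph.row, Function.comp_def, -List.map_coe_finRange_eq_range]

theorem map_get_finRange_eq_map {α β : Type*} (l : List α) (g : α → β) :
    (List.finRange l.length).map (fun u => g (l.get u)) = l.map g := by
  conv_rhs => rw [← List.map_get_finRange l, List.map_map]
  rfl

/-- The arcs of a graph, given by the row, the column and the position in the encoding of the
adjacency matrix. -/
def FinGraph.arcs (G : FinGraph) : List (ℕ × ℕ × ℕ) := (entries 0 0 0 G.encode).reverse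

theorem FinGraph.mem_arcs (G : FinGraph) (e : ℕ × ℕ × ℕ) :
    e ∈ G.arcs ↔ (∃ (hr : e.1 < G.n) (hc : e.2.1 < G.n), G.graph.Adj ⟨e.1, hr⟩ ⟨e.2.1, hc⟩) ∧
      e.2.2 = e.1 * (G.n + 1) + e.2.1 := by
  classical
  rw [FinGraph.arcs, List.mem_reverse, FinGraph.encode_eq_range',
    mem_entries_matrix (fun r c =>
      decide (∃ (hr : r < G.n) (hc : c < G.n), G.graph.Adj ⟨r, hr⟩ ⟨c, hc⟩))]
  simp only [zero_le, true_and, zero_add, zero_mul, add_zero, decide_eq_true_eq]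
  constructor
  · rintro ⟨_, _, h, h'⟩
    exact ⟨h, h'⟩
  · rintro ⟨⟨hr, hc, h⟩, h'⟩
    exact ⟨hr, hc, ⟨hr, hc, h⟩, h'⟩

theorem FinGraph.nodup_arcs (G : FinGraph) : G.arcs.Nodup :=
  List.nodup_reverse.2 (nodup_entries _ _ _ _)

/-- The complement of the underlying graph of `δG`, on the list of arcs of `G`. -/
def lineCompl (G : FinGraph) : FinGraph where
  n := G.arcs.length
  graph :=
    { Adj := fun u v => lineEntry (G.arcs.get u) (G.arcs.get v) = some true
      symm := ⟨fun u v h => by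
        simp only [lineEntry, Option.some.injEq, Bool.not_eq_true', Bool.or_eq_false_iff,
          decide_eq_false_iff_not] at h ⊢
        exact ⟨⟨Ne.symm h.1.2, Ne.symm h.1.1⟩, Ne.symm h.2⟩⟩
      loopless := ⟨fun u h => by simp [lineEntry] at h⟩ }

/-- The output stack reverses what is pushed. Listing the arcs backwards absorbs this for rows and
columns alike, and the separator pushed before each row ends up after it. -/
theorem encode_lineCompl (G : FinGraph) :
    (lineCompl G).encode = (rows G.encode 0 0 0 G.encode).reverse := by
  classical
  have hrow : ∀ u, (lineCompl G).row u =
      G.arcs.map (lineEntry (G.arcs.get u)) ++ [none] := by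
    intro u
    rw [← map_get_finRange_eq_map]
    refine congrArg (· ++ [none]) (List.map_congr_left fun v _ => ?_)
    simp only [lineCompl, lineEntry, Option.some.injEq]
    exact Bool.decide_eq_true
  rw [rows_eq_flatMap, List.reverse_flatMap, FinGraph.encode, List.flatMap_def]
  change _ = (G.arcs.map _).flatten
  rw [← map_get_finRange_eq_map G.arcs]
  refine congrArg List.flatten (List.map_congr_left fun u _ => ?_)
  rw [hrow]
  simp [FinGraph.arcs, List.map_reverse]

/-- Each listed triple is sent to its arc (row, column). Comparing positions is a valid equality
test for arcs, since `r * (n + 1) + c` with `c < n` determines `r` and `c`. -/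
theorem nonempty_lineCompl_iso (G : FinGraph) :
    Nonempty ((lineCompl G).graph ≃g (underlyingLine G.graph)ᶜ) := by
  have hmem : ∀ u : Fin (lineCompl G).n, _ := fun u =>
    (G.mem_arcs (G.arcs.get u)).1 (List.get_mem _ _)
  let φ : Fin (lineCompl G).n → {e : Fin G.n × Fin G.n // (bidirected G.graph).Adj e.1 e.2} :=
    fun u => ⟨(⟨_, (hmem u).1.1⟩, ⟨_, (hmem u).1.2.1⟩), (hmem u).1.2.2⟩
  have hφ : ∀ u v, φ u = φ v ↔ (G.arcs.get u).2.2 = (G.arcs.get v).2.2 := by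
    intro u v
    constructor
    · intro h
      have h1 : (G.arcs.get u).1 = (G.arcs.get v).1 := congrArg (fun e => (e.1.1 : ℕ)) h
      have h2 : (G.arcs.get u).2.1 = (G.arcs.get v).2.1 := congrArg (fun e => (e.1.2 : ℕ)) h
      rw [(hmem u).2, (hmem v).2, h1, h2]
    · intro h
      rw [(hmem u).2, (hmem v).2] at h
      have hu := (hmem u).1.2.1
      have hv := (hmem v).1.2.1
      have h1 : (G.arcs.get u).1 = (G.arcs.get v).1 := by
        -- Division by `G.n + 1` recovers the row, the columns being smaller than the divisor.
        have := congrArg (· / (G.n + 1)) h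
        simpa [Nat.add_div_of_dvd_right, Nat.mul_add_div, mul_comm _ (G.n + 1),
          Nat.div_eq_of_lt (hu.trans (Nat.lt_succ_self _)),
          Nat.div_eq_of_lt (hv.trans (Nat.lt_succ_self _))] using this
      rw [h1, Nat.add_left_cancel_iff] at h
      exact Subtype.ext (Prod.ext (Fin.ext h1) (Fin.ext h))
  have hinj : Function.Injective φ := by
    intro u v h
    have h1 : (G.arcs.get u).1 = (G.arcs.get v).1 := congrArg (fun e => (e.1.1 : ℕ)) h
    have h2 : (G.arcs.get u).2.1 = (G.arcs.get v).2.1 := congrArg (fun e => (e.1.2 : ℕ)) h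
    exact G.nodup_arcs.injective_get (Prod.ext h1 (Prod.ext h2 ((hφ u v).1 h)))
  have hsurj : Function.Surjective φ := by
    rintro ⟨⟨r, c⟩, h⟩
    obtain ⟨u, hu⟩ := List.get_of_mem ((G.mem_arcs (r, c, r * (G.n + 1) + c)).2
      ⟨⟨r.2, c.2, h⟩, rfl⟩)
    refine ⟨u, Subtype.ext (Prod.ext (Fin.ext ?_) (Fin.ext ?_))⟩
    · exact congrArg Prod.fst hu
    · exact congrArg (fun e => e.2.1) hu
  refine ⟨⟨Equiv.ofBijective φ ⟨hinj, hsurj⟩, fun {u v} => ?_⟩⟩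
  change (underlyingLine G.graph)ᶜ.Adj (φ u) (φ v) ↔ _
  rw [SimpleGraph.compl_adj, underlyingLine_adj, Ne, hφ]
  have h1 : (φ u).1.2 = (φ v).1.1 ↔ (G.arcs.get v).1 = (G.arcs.get u).2.1 :=
    Fin.ext_iff.trans eq_comm
  have h2 : (φ v).1.2 = (φ u).1.1 ↔ (G.arcs.get v).2.1 = (G.arcs.get u).1 := Fin.ext_iff
  rw [h1, h2]
  simp only [lineCompl, lineEntry, Option.some.injEq, Bool.not_eq_true', Bool.or_eq_false_iff,
    decide_eq_false_iff_not, eq_comm (a := (G.arcs.get v).2.2)]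
  tauto

end LineIndex
end

theorem theorem4p6 (Sig : Type*) [Fintype Sig] (hSig : 2 ≤ Fintype.card Sig)
    (k₁ k₂ : ℕ) (hk₂ : 2 ≤ k₂) :
    ∃ f : LineIndex.FinGraph → LineIndex.FinGraph,
      (∀ G, Nonempty ((f G).graph ≃g (LineIndex.underlyingLine G.graph)ᶜ)) ∧
      LineIndex.IsPolyTimeReduction f
        (LineIndex.chromaticGap (LineIndex.b k₁) k₂)
        (LineIndex.IC Sig k₁ (Real.logb (Fintype.card Sig) (Real.logb 2 k₂))) := by
  have : Nontrivial Sig := Fintype.one_lt_card_iff_nontrivial.1 hSig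
  refine ⟨LineIndex.lineCompl, LineIndex.nonempty_lineCompl_iso,
    LineIndex.Machine.nonempty_computable _ _ LineIndex.encode_lineCompl, fun G hG => ?_,
    fun G hG => ?_⟩
  · obtain ⟨φ⟩ := LineIndex.nonempty_lineCompl_iso G
    exact LineIndex.IC_yes_of_chromaticGap_yes φ hG
  · obtain ⟨φ⟩ := LineIndex.nonempty_lineCompl_iso G
    exact LineIndex.IC_no_of_chromaticGap_no φ hk₂ hG
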